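/- Let $L,P$ be positive integers with $\sqrt{L}-\sqrt{\log L}>\sqrt{P}$ (natural logarithm), let $\sigma_x\ge 0$, $\sigma_z>0$, and let $w^*,w_t\in\mathbb{R}^L$ be fixed (deterministic) vectors with $w_t\neq w^*$. Let $X_t\in\mathbb{R}^{L\times P}$ and $Z_t\in\mathbb{R}^P$ be independent, where the entries of $X_t$ are i.i.d. $\mathcal N(0,\sigma_x^2)$ and the entries of $Z_t$ are i.i.d. $\mathcal N(0,\sigma_z^2)$, and let $y_t=X_t^Tw^*+Z_t$. Put $$c_t=\frac{\|w_t-w^*\|^2}{L\sigma_z^2},\qquad w_{t+1}=w_t+X_t\Big(\frac1{c_t}I_P+X_t^TX_t\Big)^{-1}(y_t-X_t^Tw_t),$$ where $\|\cdot\|$ is the Euclidean norm (one genie-aided online block maximum likelihood update), and $r_t=\|w_t-w^*\|^2$, $r_{t+1}=\|w_{t+1}-w^*\|^2$. Then $r_{t+1}$ is integrable and $$\mathbb{E}[r_{t+1}]\le\left(1-(1-\gamma_L)\,\frac{P}{L}\,\frac{\sigma_x^2r_t}{\sigma_z^2+\sigma_x^2r_t}\right)r_t,$$ where $$\gamma_L=1-\Big(1-\sqrt{\tfrac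 PL}-\sqrt{\tfrac{\log L}{L}}\Big)^2\Big(1-\frac{2}{\sqrt L}\Big)$$ depends only on $P$ and $L$, and for every fixed $P$ one has $\gamma_L=O\big(\sqrt{\log L/L}\big)$ as $L\to\infty$. -/

import Mathlib

open MeasureTheory ProbabilityTheory Filter Asymptotics
open scoped NNReal Matrix

/-- The confidence parameter `c = ‖w - w*‖² / (σ_z² L)` of the current estimate `w`. -/
noncomputable def confidence {L : ℕ} (σz : ℝ) (wstar w : EuclideanSpace ℝ (Fin L)) : ℝ :=
  ‖w - wstar‖ ^ 2 / (σz ^ 2 * L)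

/-- One GA-OBML update
`w + X ((1 / c) I_P + Xᵀ X)⁻¹ (y - Xᵀ w)` with `c` the confidence parameter of `w`. -/
noncomputable def gaOBMLUpdate {L P : ℕ} (σz : ℝ) (wstar w : EuclideanSpace ℝ (Fin L))
    (X : Matrix (Fin L) (Fin P) ℝ) (y : Fin P → ℝ) : EuclideanSpace ℝ (Fin L) :=
  w + WithLp.toLp 2
    (X *ᵥ (((1 / confidence σz wstar w) • (1 : Matrix (Fin P) (Fin P) ℝ) + Xᵀ * X)⁻¹ *ᵥ
      (y - Xᵀ *ᵥ w.ofLp)))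

/-- The constant
`γ_L = 1 - (1 - √(P / L) - √(log L / L))² (1 - 2 / √L)`, depending only on `P` and `L`. -/
noncomputable def gammaConst (P L : ℕ) : ℝ :=
  1 - (1 - √((P : ℝ) / L) - √(Real.log L / L)) ^ 2 * (1 - 2 / √(L : ℝ))

/-! The error after an update is `K d + G z`. Here `d = w - w*`, `K` is `residual`, `G` is `gain`,
and `K² + (1/c) G Gᵀ = K` (`residual_mul_self_add`). Averaging over the independent centred noise
gives `‖K d‖² + σz² tr(G Gᵀ)`. The Gaussian design is invariant under signed row permutations, so
`E[K²]` is a scalar matrix and `L · E‖K d‖² = r · E tr K²` (`integral_sum_residual_mulVec_sq`).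
Since `r = c L σz²`, the noise term contributes exactly `r · E(tr K - tr K²)`. The squares cancel,
leaving the exact formula `L · E[r'] = r · E tr K` (`card_mul_integral_sum_update_sq`).

Moreover `tr K = L - P + tr (1 + c XᵀX)⁻¹`. No concentration of singular values is needed. Expanding
`1/(1+x)` to second order around the mean `a = c L σx²` of `c XᵀX` (`trace_smul_gramInv_le`) leaves
only a second moment of Gaussian products, which equals `a² P (P + 1) / L`. With `ρ = a/(1+a)`, the
ratio in the theorem, this gives `E tr K ≤ L - P ρ (1 - ρ (P + 1) / L)`. The bound is sharper than
required, because `1 - γ_L ≤ 1 - (P + 1) / L` (`one_sub_gammaConst_le`). -/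

/-! ### Estimates for the constant `γ_L` -/

theorem gammaConst_isBigO (P : ℕ) :
    (fun L : ℕ => gammaConst P L) =O[atTop] fun L : ℕ => √(Real.log L / L) := by
  refine IsBigO.of_bound (2 * (√(P : ℝ) + 1) + (√(P : ℝ) + 1) ^ 2 + 2 * (1 + (√(P : ℝ) + 1)) ^ 2) ?_
  -- From `L ≥ 3 > e` on, `log L ≥ 1`, so `1/√L` is dominated by `√(log L / L)`.
  filter_upwards [eventually_ge_atTop 3] with L hL
  have hL' : (3 : ℝ) ≤ L := by exact_mod_cast hL
  have hL0 : (0 : ℝ) < L := by linarith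
  have hlog : 1 ≤ Real.log L := by
    rw [Real.le_log_iff_exp_le hL0]
    exact (Real.exp_one_lt_d9.le.trans (by norm_num)).trans hL'
  set v := √(Real.log L / L) with hv
  set k := √(P : ℝ)
  have hk : 0 ≤ k := Real.sqrt_nonneg _
  have hv0 : 0 ≤ v := Real.sqrt_nonneg _
  have hv1 : v ≤ 1 := by
    refine Real.sqrt_le_one.2 ((div_le_one hL0).2 ?_)
    exact (Real.log_le_sub_one_of_pos hL0).trans (by linarith)
  have hs : 1 / √(L : ℝ) ≤ v := by
    rw [← Real.sqrt_one, ← Real.sqrt_div zero_le_one]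
    exact Real.sqrt_le_sqrt (by gcongr)
  have hu : √((P : ℝ) / L) = k * (1 / √(L : ℝ)) := by
    rw [Real.sqrt_div (Nat.cast_nonneg P)]; ring
  have hs0 : 0 ≤ 1 / √(L : ℝ) := by positivity
  rw [Real.norm_of_nonneg hv0, gammaConst, hu, ← hv, Real.norm_eq_abs]
  have h2 : 2 / √(L : ℝ) = 2 * (1 / √(L : ℝ)) := by ring
  rw [h2]
  generalize 1 / √(L : ℝ) = s at *
  set t := k * s + v with ht
  have ht0 : 0 ≤ t := by positivity
  have htk : t ≤ (k + 1) * v := by nlinarith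
  have htk1 : t ≤ k + 1 := htk.trans (by nlinarith)
  -- Each of the three summands is at most a constant times `v`; these constants add up to the one
  -- supplied at the start.
  have e : 1 - (1 - k * s - v) ^ 2 * (1 - 2 * s) = 2 * t - t ^ 2 + 2 * s * (1 - t) ^ 2 := by
    rw [ht]; ring
  rw [e]
  have b1 : t ^ 2 ≤ (k + 1) ^ 2 * v := by
    calc t ^ 2 = t * t := by ring
      _ ≤ (k + 1) * ((k + 1) * v) := by gcongr
      _ = _ := by ring
  have b2 : (1 - t) ^ 2 ≤ (1 + (k + 1)) ^ 2 := by
    apply sq_le_sq'  <;> linarith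
  have b3 : 2 * s * (1 - t) ^ 2 ≤ 2 * v * (1 + (k + 1)) ^ 2 := by gcongr
  have b4 : 0 ≤ 2 * s * (1 - t) ^ 2 := by positivity
  have b5 : 0 ≤ v * (1 + (k + 1)) ^ 2 := by positivity
  rw [abs_le]
  constructor <;> nlinarith

/-- Once the factor `1 - 2/√L` is dropped (or is nonpositive), this says `(√L - √P - √log L)² ≤ L -
P - 1`. Put `q = √P + √log L < √L`. Then `L - (√L - q)² = q (2√L - q) ≥ q² ≥ P + 2 √P √log L`, and
the last product is at least `1`. -/
theorem one_sub_gammaConst_le {L P : ℕ} (hP : 0 < P)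
    (h : √(L : ℝ) - √(Real.log L) > √(P : ℝ)) :
    1 - gammaConst P L ≤ 1 - ((P : ℝ) + 1) / L := by
  have hP1 : (1 : ℝ) ≤ P := by exact_mod_cast hP
  have hPs : 1 ≤ √(P : ℝ) := Real.one_le_sqrt.2 hP1
  have hl0 : 0 ≤ √(Real.log L) := Real.sqrt_nonneg _
  have hPL : (P : ℝ) < L := by
    rw [← Real.sqrt_lt_sqrt_iff (by positivity)]; linarith
  have hL2 : 2 ≤ L := by
    have : P < L := by exact_mod_cast hPL
    omega
  have hL2' : (2 : ℝ) ≤ L := by exact_mod_cast hL2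
  have hL0 : (0 : ℝ) < L := by linarith
  have hsL : 0 < √(L : ℝ) := Real.sqrt_pos.2 hL0
  -- The value `1/2` is what makes `2 √P √log L ≥ 1` when `P ≥ 1`; it follows from `log 2 > 1/4`.
  have hlog : 1 / 2 ≤ √(Real.log L) := by
    apply Real.le_sqrt_of_sq_le
    have := Real.log_le_log (by norm_num) hL2'
    have := Real.log_two_gt_d9
    norm_num; linarith
  have hPL1 : (P : ℝ) + 1 ≤ L := by
    have : P < L := by exact_mod_cast hPL
    exact_mod_cast this
  have hrhs : 0 ≤ 1 - ((P : ℝ) + 1) / L := by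
    rw [sub_nonneg, div_le_one hL0]; exact hPL1
  have e : 1 - gammaConst P L = (1 - √((P : ℝ) / L) - √(Real.log L / L)) ^ 2 * (1 - 2 / √(L : ℝ)) := by
    rw [gammaConst]; ring
  rw [e]
  rcases le_total (1 - 2 / √(L : ℝ)) 0 with hneg | hpos
  · exact (mul_nonpos_of_nonneg_of_nonpos (sq_nonneg _) hneg).trans hrhs
  have hle1 : 1 - 2 / √(L : ℝ) ≤ 1 := by
    have : 0 ≤ 2 / √(L : ℝ) := by positivity
    linarith
  refine (mul_le_of_le_one_right (sq_nonneg _) hle1).trans ?_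
  rw [Real.sqrt_div (Nat.cast_nonneg P), Real.sqrt_div (Real.log_nonneg (by linarith))]
  have e2 : 1 - √(P : ℝ) / √(L : ℝ) - √(Real.log L) / √(L : ℝ)
      = (√(L : ℝ) - √(P : ℝ) - √(Real.log L)) / √(L : ℝ) := by field_simp
  rw [e2, div_pow, Real.sq_sqrt hL0.le, div_le_iff₀ hL0, sub_mul, div_mul_cancel₀ _ hL0.ne']
  have hq := Real.sq_sqrt hL0.le
  have hp := Real.sq_sqrt (Nat.cast_nonneg (α := ℝ) P)
  nlinarith [mul_nonneg (sub_nonneg.2 hPs) (sub_nonneg.2 hlog),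
    mul_pos (show 0 < √(L : ℝ) - √(P : ℝ) - √(Real.log L) by linarith) hsL]

namespace RidgeUpdate
-- Algebra of the regularized inverse and the residual matrix
section algebra
variable {m n : Type*} [Fintype m] [Fintype n]

theorem posSemidef_transpose_mul_self (X : Matrix m n ℝ) : (Xᵀ * X).PosSemidef := by
  simpa using Matrix.posSemidef_conjTranspose_mul_self X

variable [DecidableEq n]

/-- The regularized inverse Gram matrix `((1 / c) I + Xᵀ X)⁻¹`. -/
noncomputable def gramInv (c : ℝ) (X : Matrix m n ℝ) : Matrix n n ℝ :=
  ((1 / c) • (1 : Matrix n n ℝ) + Xᵀ * X)⁻¹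

/-- The matrix applied to the noise in the update. -/
noncomputable def gain (c : ℝ) (X : Matrix m n ℝ) : Matrix m n ℝ := X * gramInv c X

theorem gramInv_transpose (c : ℝ) (X : Matrix m n ℝ) : (gramInv c X)ᵀ = gramInv c X := by
  simp [gramInv, Matrix.transpose_nonsing_inv]

theorem posDef_regularized {c : ℝ} (hc : 0 < c) (X : Matrix m n ℝ) :
    ((1 / c) • (1 : Matrix n n ℝ) + Xᵀ * X).PosDef :=
  (Matrix.PosDef.one.smul (one_div_pos.2 hc)).add_posSemidef (posSemidef_transpose_mul_self X)

theorem isUnit_det_regularized {c : ℝ} (hc : 0 < c) (X : Matrix m n ℝ) :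
    IsUnit ((1 / c) • (1 : Matrix n n ℝ) + Xᵀ * X).det :=
  (Matrix.isUnit_iff_isUnit_det _).1 (posDef_regularized hc X).isUnit

theorem gramInv_mul_gram {c : ℝ} (hc : 0 < c) (X : Matrix m n ℝ) :
    gramInv c X * (Xᵀ * X) = 1 - (1 / c) • gramInv c X := by
  have h := Matrix.nonsing_inv_mul _ (isUnit_det_regularized hc X)
  rw [Matrix.mul_add, Matrix.mul_smul, Matrix.mul_one] at h
  exact eq_sub_of_add_eq' h

theorem gram_mul_gramInv {c : ℝ} (hc : 0 < c) (X : Matrix m n ℝ) :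
    Xᵀ * X * gramInv c X = 1 - (1 / c) • gramInv c X := by
  have h := Matrix.mul_nonsing_inv _ (isUnit_det_regularized hc X)
  rw [Matrix.add_mul, Matrix.smul_mul, Matrix.one_mul] at h
  exact eq_sub_of_add_eq' h

/-- A quadratic upper bound for the trace of `(1 + c Xᵀ X)⁻¹`, by expansion around `a`. -/
theorem trace_smul_gramInv_le {c a : ℝ} (hc : 0 < c) (ha : 0 ≤ a) (X : Matrix m n ℝ) :
    ((1 / c) • gramInv c X).trace ≤ Fintype.card n / (1 + a)
      - (c • (Xᵀ * X) - a • (1 : Matrix n n ℝ)).trace / (1 + a) ^ 2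
      + ((c • (Xᵀ * X) - a • (1 : Matrix n n ℝ)) *
          (c • (Xᵀ * X) - a • (1 : Matrix n n ℝ))).trace / (1 + a) ^ 2 := by
  set R := (1 / c) • gramInv c X with hR
  set B := c • (Xᵀ * X) with hB
  set D := B - a • (1 : Matrix n n ℝ) with hD
  have hcc : c * (1 / c) = 1 := by field_simp
  have hRB : R * B = 1 - R := by
    rw [hR, hB, Matrix.smul_mul, Matrix.mul_smul, smul_smul, mul_comm, hcc, one_smul,
      gramInv_mul_gram hc]
  have hBR : B * R = 1 - R := by
    rw [hR, hB, Matrix.smul_mul, Matrix.mul_smul, smul_smul, hcc, one_smul,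
      gram_mul_gramInv hc]
  have hBps : B.PosSemidef := (posSemidef_transpose_mul_self X).smul hc.le
  have hRT : Rᴴ = R := by
    rw [Matrix.conjTranspose_eq_transpose_of_trivial, hR, Matrix.transpose_smul,
      gramInv_transpose]
  have hBT : Bᴴ = B := hBps.isHermitian
  have hDT : Dᴴ = D := by
    rw [hD, Matrix.conjTranspose_sub, hBT]; simp
  -- With `R = (1 + B)⁻¹`, `1 - R = RB` splits as `R B R + (1 - R)²`, a sum of positive semidefinite
  -- terms.
  have h1R : (1 - R).PosSemidef := by
    have e : 1 - R = R * B * Rᴴ + (R * B) * 1 * (R * B)ᴴ := by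
      have : (R * B)ᴴ = 1 - R := by rw [Matrix.conjTranspose_mul, hRT, hBT, hBR]
      rw [hRT, this, hRB]
      noncomm_ring
    rw [e]
    exact (hBps.mul_mul_conjTranspose_same R).add
      (Matrix.PosSemidef.one.mul_mul_conjTranspose_same (R * B))
  -- The exact second-order remainder is `D R D / (1 + a)²`; since `R ≤ 1`, its trace is at most
  -- that of `D² / (1 + a)²`.
  have hT : 0 ≤ (D * (1 - R) * D).trace := by
    have := (h1R.mul_mul_conjTranspose_same D).trace_nonneg
    rwa [hDT] at this
  have hRD : R * D = 1 - (1 + a) • R := by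
    rw [hD, Matrix.mul_sub, hRB, Matrix.mul_smul, Matrix.mul_one, add_smul, one_smul]; abel
  have hDRD : D * R * D = D - (1 + a) • (1 - (1 + a) • R) := by
    have hDR : D * R = 1 - (1 + a) • R := by
      rw [hD, Matrix.sub_mul, hBR, Matrix.smul_mul, Matrix.one_mul, add_smul, one_smul]; abel
    rw [hDR, Matrix.sub_mul, Matrix.one_mul, Matrix.smul_mul, hRD]
  have hexp : (D * (1 - R) * D).trace
      = (D * D).trace - D.trace + (1 + a) * (Fintype.card n - (1 + a) * R.trace) := by
    have e : D * (1 - R) * D = D * D - D * R * D := by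
      rw [Matrix.mul_sub D 1 R, Matrix.mul_one, Matrix.sub_mul]
    rw [e, hDRD]
    simp only [Matrix.trace_sub, Matrix.trace_smul, Matrix.trace_one, smul_eq_mul]
    ring
  have h1a : 0 < 1 + a := by linarith
  rw [hexp] at hT
  have e : (Fintype.card n : ℝ) / (1 + a) - D.trace / (1 + a) ^ 2 + (D * D).trace / (1 + a) ^ 2
      = ((1 + a) * Fintype.card n - D.trace + (D * D).trace) / (1 + a) ^ 2 := by
    field_simp
  rw [e, le_div_iff₀ (by positivity)]
  nlinarith

/-- By Cramer's rule, as the regularized determinant never vanishes. Continuity supplies the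
measurability used in all later integrals. -/
theorem continuous_gramInv {c : ℝ} (hc : 0 < c) :
    Continuous fun X : Matrix m n ℝ => gramInv c X := by
  have hcont : Continuous fun X : Matrix m n ℝ => (1 / c) • (1 : Matrix n n ℝ) + Xᵀ * X := by
    fun_prop
  have e : (fun X : Matrix m n ℝ => gramInv c X) = fun X =>
      ((1 / c) • (1 : Matrix n n ℝ) + Xᵀ * X).det⁻¹ •
        ((1 / c) • (1 : Matrix n n ℝ) + Xᵀ * X).adjugate := by
    funext X
    rw [gramInv, Matrix.inv_def, Ring.inverse_eq_inv]
  rw [e]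
  exact (hcont.matrix_det.inv₀ fun X => (isUnit_det_regularized hc X).ne_zero).smul
    hcont.matrix_adjugate

theorem continuous_gain {c : ℝ} (hc : 0 < c) :
    Continuous fun X : Matrix m n ℝ => gain c X :=
  continuous_id.matrix_mul (continuous_gramInv hc)

variable [DecidableEq m]

/-- The matrix applied to the current error in the update. -/
noncomputable def residual (c : ℝ) (X : Matrix m n ℝ) : Matrix m m ℝ := 1 - gain c X * Xᵀ

theorem residual_transpose (c : ℝ) (X : Matrix m n ℝ) : (residual c X)ᵀ = residual c X := by
  simp [residual, gain, gramInv_transpose, Matrix.mul_assoc]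

/-- The key identity: it trades the noise amplification `G Gᵀ` for `K - K²`, and its diagonal bounds
all entries of `K` and `G`. -/
theorem residual_mul_self_add {c : ℝ} (hc : 0 < c) (X : Matrix m n ℝ) :
    residual c X * residual c X + (1 / c) • (gain c X * (gain c X)ᵀ) = residual c X := by
  have h : gain c X * Xᵀ * (gain c X * Xᵀ)
      = gain c X * Xᵀ - (1 / c) • (gain c X * (gain c X)ᵀ) := by
    calc gain c X * Xᵀ * (gain c X * Xᵀ)
        = X * (gramInv c X * (Xᵀ * X)) * gramInv c X * Xᵀ := by
          simp only [gain, Matrix.mul_assoc]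
      _ = _ := by
          rw [gramInv_mul_gram hc]
          simp only [gain, Matrix.mul_sub, Matrix.sub_mul, Matrix.mul_one, Matrix.mul_smul,
            Matrix.smul_mul, Matrix.transpose_mul, gramInv_transpose, Matrix.mul_assoc]
  have e : (1 - gain c X * Xᵀ) * (1 - gain c X * Xᵀ)
      = 1 - gain c X * Xᵀ - gain c X * Xᵀ + gain c X * Xᵀ * (gain c X * Xᵀ) := by noncomm_ring
  rw [residual, e, h]
  abel

theorem residual_diag {c : ℝ} (hc : 0 < c) (X : Matrix m n ℝ) (i : m) :
    ∑ k, residual c X i k ^ 2 + (1 / c) * ∑ j, gain c X i j ^ 2 = residual c X i i := by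
  conv_rhs => rw [← residual_mul_self_add hc X]
  simp only [Matrix.add_apply, Matrix.smul_apply, smul_eq_mul, Matrix.mul_apply,
    Matrix.transpose_apply, sq]
  congr 1
  refine Finset.sum_congr rfl fun k _ => ?_
  conv_rhs => rw [← residual_transpose c X]
  rw [Matrix.transpose_apply, ← Matrix.transpose_apply (residual c X), residual_transpose]

/-- The diagonal identity forces `K i i ^ 2 ≤ K i i`. -/
theorem residual_diag_bounds {c : ℝ} (hc : 0 < c) (X : Matrix m n ℝ) (i : m) :
    0 ≤ residual c X i i ∧ residual c X i i ≤ 1 := by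
  have h := residual_diag hc X i
  have h1 : 0 ≤ (1 / c) * ∑ j, gain c X i j ^ 2 := by positivity
  have h2 : residual c X i i ^ 2 ≤ ∑ k, residual c X i k ^ 2 :=
    Finset.single_le_sum (f := fun k => residual c X i k ^ 2) (fun k _ => sq_nonneg _)
      (Finset.mem_univ i)
  constructor <;> nlinarith

theorem abs_residual_le_one {c : ℝ} (hc : 0 < c) (X : Matrix m n ℝ) (i k : m) :
    |residual c X i k| ≤ 1 := by
  have h := residual_diag hc X i
  have h1 : 0 ≤ (1 / c) * ∑ j, gain c X i j ^ 2 := by positivity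
  have h2 : residual c X i k ^ 2 ≤ ∑ k, residual c X i k ^ 2 :=
    Finset.single_le_sum (f := fun k => residual c X i k ^ 2) (fun k _ => sq_nonneg _)
      (Finset.mem_univ k)
  have := (residual_diag_bounds hc X i).2
  rw [← sq_le_one_iff_abs_le_one]
  linarith

theorem abs_gain_le {c : ℝ} (hc : 0 < c) (X : Matrix m n ℝ) (i : m) (j : n) :
    |gain c X i j| ≤ √c := by
  have h := residual_diag hc X i
  have h1 : 0 ≤ ∑ k, residual c X i k ^ 2 := by positivity
  have h2 : gain c X i j ^ 2 ≤ ∑ j, gain c X i j ^ 2 :=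
    Finset.single_le_sum (f := fun k => gain c X i k ^ 2) (fun k _ => sq_nonneg _)
      (Finset.mem_univ j)
  have h3 := (residual_diag_bounds hc X i).2
  have h4 : ∑ j, gain c X i j ^ 2 ≤ c := by
    have : (1 / c) * ∑ j, gain c X i j ^ 2 ≤ 1 := by linarith
    rwa [one_div, inv_mul_le_iff₀ hc, mul_one] at this
  exact Real.abs_le_sqrt (h2.trans h4)

/-- Cyclicity of the trace moves the problem from the `m × m` residual to the `n × n` Gram matrix.
-/
theorem trace_residual {c : ℝ} (hc : 0 < c) (X : Matrix m n ℝ) :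
    (residual c X).trace
      = Fintype.card m - Fintype.card n + ((1 / c) • gramInv c X).trace := by
  rw [residual, gain, Matrix.trace_sub, Matrix.mul_assoc, Matrix.trace_mul_comm, Matrix.mul_assoc,
    gramInv_mul_gram hc, Matrix.trace_sub, Matrix.trace_one, Matrix.trace_one]
  ring

theorem gramInv_orthogonal_mul (c : ℝ) {U : Matrix m m ℝ} (hU : Uᵀ * U = 1) (X : Matrix m n ℝ) :
    gramInv c (U * X) = gramInv c X := by
  rw [gramInv, Matrix.transpose_mul, Matrix.mul_assoc, ← Matrix.mul_assoc Uᵀ, hU, Matrix.one_mul,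
    gramInv]

theorem residual_orthogonal_mul (c : ℝ) {U : Matrix m m ℝ} (hU : Uᵀ * U = 1)
    (X : Matrix m n ℝ) : residual c (U * X) = U * residual c X * Uᵀ := by
  have hU' : U * Uᵀ = 1 := mul_eq_one_comm.1 hU
  simp only [residual, gain, gramInv_orthogonal_mul c hU, Matrix.mul_sub, Matrix.sub_mul,
    Matrix.mul_one, hU', Matrix.transpose_mul, Matrix.mul_assoc]

theorem residual_sq_orthogonal_mul (c : ℝ) {U : Matrix m m ℝ} (hU : Uᵀ * U = 1)
    (X : Matrix m n ℝ) : residual c (U * X) * residual c (U * X)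
      = U * (residual c X * residual c X) * Uᵀ := by
  rw [residual_orthogonal_mul c hU]
  calc U * residual c X * Uᵀ * (U * residual c X * Uᵀ)
      = U * residual c X * (Uᵀ * U) * residual c X * Uᵀ := by simp only [Matrix.mul_assoc]
    _ = _ := by rw [hU]; simp only [Matrix.mul_one, Matrix.mul_assoc]

theorem continuous_residual {c : ℝ} (hc : 0 < c) :
    Continuous fun X : Matrix m n ℝ => residual c X :=
  continuous_const.sub ((continuous_gain hc).matrix_mul continuous_id.matrix_transpose)

end algebra

/-! ### The update error as residual plus filtered noise -/

theorem norm_update_sub_sq {L P : ℕ} (σz : ℝ) (wstar w : EuclideanSpace ℝ (Fin L))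
    (X : Matrix (Fin L) (Fin P) ℝ) (z : Fin P → ℝ) :
    ‖gaOBMLUpdate σz wstar w X (Xᵀ *ᵥ wstar.ofLp + z) - wstar‖ ^ 2
      = ∑ i, ((residual (confidence σz wstar w) X *ᵥ (w - wstar).ofLp) i
          + (gain (confidence σz wstar w) X *ᵥ z) i) ^ 2 := by
  rw [EuclideanSpace.real_norm_sq_eq]
  refine Finset.sum_congr rfl fun i _ => ?_
  congr 1
  have e : Xᵀ *ᵥ wstar.ofLp + z - Xᵀ *ᵥ w.ofLp = z - Xᵀ *ᵥ (w - wstar).ofLp := by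
    rw [WithLp.ofLp_sub, Matrix.mulVec_sub]; abel
  simp only [gaOBMLUpdate, e]
  simp only [residual, gain, gramInv, Matrix.sub_mulVec, Matrix.mulVec_sub, Matrix.one_mulVec,
    Matrix.mulVec_mulVec, Matrix.mul_assoc, PiLp.sub_apply, PiLp.add_apply, Pi.sub_apply,
    WithLp.ofLp_sub]
  ring

/-! ### Moments of Gaussian variables -/

section gaussian

theorem integral_pow_four_gaussianReal (v : ℝ≥0) :
    ∫ x, x ^ 4 ∂gaussianReal 0 v = 3 * (v : ℝ) ^ 2 := by
  have h0 : (0 : ℝ) ∈ interior (integrableExpSet id (gaussianReal 0 v)) := by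
    simp [integrableExpSet_id_gaussianReal]
  have h := iteratedDeriv_mgf_zero h0 4
  rw [mgf_id_gaussianReal] at h
  -- Differentiating the moment generating function sends the polynomial prefactor `q` to `q' + v t
  -- q`. Four rounds from `q = 1` give constant term `3 v²`.
  have e : ∀ (q q' r : ℝ → ℝ), (∀ t, HasDerivAt q (q' t) t) → (∀ t, q' t + v * t * q t = r t) →
      deriv (fun t => q t * Real.exp (0 * t + v * t ^ 2 / 2))
        = fun t => r t * Real.exp (0 * t + v * t ^ 2 / 2) := by
    intro q q' r hq hr
    funext t
    have h1 : HasDerivAt (fun t : ℝ => 0 * t + v * t ^ 2 / 2) (v * t) t := by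
      refine (((hasDerivAt_id' t).const_mul 0).fun_add
        (((hasDerivAt_pow 2 t).const_mul (v : ℝ)).div_const 2)).congr_deriv ?_
      norm_num
      ring
    refine ((hq t).fun_mul h1.exp).deriv.trans ?_
    rw [← hr t]
    ring
  have e0 : (fun t : ℝ => Real.exp (0 * t + v * t ^ 2 / 2))
      = fun t => (fun _ => (1 : ℝ)) t * Real.exp (0 * t + v * t ^ 2 / 2) := by simp
  have hpow (k : ℕ) (a t : ℝ) : HasDerivAt (fun t : ℝ => a * t ^ k) (a * (k * t ^ (k - 1))) t :=
    (hasDerivAt_pow k t).const_mul a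
  rw [e0, iteratedDeriv_succ',
    e _ (fun _ => 0) (fun t => v * t ^ 1) (fun t => hasDerivAt_const t 1) (fun t => by ring),
    iteratedDeriv_succ',
    e _ _ (fun t => v + (v : ℝ) ^ 2 * t ^ 2) (fun t => hpow 1 v t) (fun t => by norm_num; ring),
    iteratedDeriv_succ',
    e _ _ (fun t => 3 * (v : ℝ) ^ 2 * t ^ 1 + (v : ℝ) ^ 3 * t ^ 3)
      (fun t => (hpow 2 ((v : ℝ) ^ 2) t).const_add (v : ℝ)) (fun t => by norm_num; ring),
    iteratedDeriv_succ',
    e _ _ (fun t => 3 * (v : ℝ) ^ 2 + 6 * (v : ℝ) ^ 3 * t ^ 2 + (v : ℝ) ^ 4 * t ^ 4)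
      (fun t => (hpow 1 (3 * (v : ℝ) ^ 2) t).fun_add (hpow 3 ((v : ℝ) ^ 3) t))
      (fun t => by norm_num; ring)] at h
  simp only [iteratedDeriv_zero] at h
  have h' : ∫ x, x ^ 4 ∂gaussianReal 0 v = ∫ x, (id ^ 4 : ℝ → ℝ) x ∂gaussianReal 0 v := rfl
  rw [h', ← h]
  simp

variable {Ω : Type*} [MeasurableSpace Ω] {μ : Measure Ω} {v : ℝ≥0} {Y : Ω → ℝ}

theorem memLp_of_hasLaw_gaussianReal (hY : HasLaw Y (gaussianReal 0 v) μ) {p : ENNReal}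
    (hp : p ≠ ⊤) : MemLp Y p μ := by
  have h := memLp_id_gaussianReal' (μ := 0) (v := v) p hp
  rw [← hY.map_eq] at h
  exact h.comp_of_map hY.aemeasurable

theorem integral_of_hasLaw_gaussianReal (hY : HasLaw Y (gaussianReal 0 v) μ) :
    ∫ ω, Y ω ∂μ = 0 := by
  rw [hY.integral_eq, integral_id_gaussianReal]

theorem integral_sq_of_hasLaw_gaussianReal (hY : HasLaw Y (gaussianReal 0 v) μ) :
    ∫ ω, Y ω ^ 2 ∂μ = v := by
  have h := variance_of_integral_eq_zero hY.aemeasurable (integral_of_hasLaw_gaussianReal hY)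
  rw [← h, hY.variance_eq, variance_id_gaussianReal]

theorem integral_pow_four_of_hasLaw_gaussianReal (hY : HasLaw Y (gaussianReal 0 v) μ) :
    ∫ ω, Y ω ^ 4 ∂μ = 3 * (v : ℝ) ^ 2 := by
  rw [← integral_pow_four_gaussianReal]
  exact hY.integral_comp (f := fun x => x ^ 4) (by fun_prop)

/-- Hölder with exponents `4, 4, 2`; independence is not needed, so the case `Y' = Y` is covered. -/
theorem memLp_two_mul_of_hasLaw_gaussianReal {Y' : Ω → ℝ}
    (hY : HasLaw Y (gaussianReal 0 v) μ) (hY' : HasLaw Y' (gaussianReal 0 v) μ) :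
    MemLp (fun ω => Y ω * Y' ω) 2 μ := by
  have : ENNReal.HolderTriple 4 4 2 := ⟨by
    rw [← two_mul, show (4 : ENNReal) = 2 * 2 by norm_num,
      ENNReal.mul_inv (by simp) (by simp), ← mul_assoc,
      ENNReal.mul_inv_cancel (by simp) (by simp), one_mul]⟩
  exact (memLp_of_hasLaw_gaussianReal hY' (p := 4) (by simp)).mul'
    (memLp_of_hasLaw_gaussianReal hY (p := 4) (by simp))

theorem integral_mul_of_iIndepFun_gaussianReal {ι : Type*} [DecidableEq ι] {Z : ι → Ω → ℝ}
    (hZ : ∀ j, HasLaw (Z j) (gaussianReal 0 v) μ) (hind : iIndepFun Z μ) (j k : ι) :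
    ∫ ω, Z j ω * Z k ω ∂μ = if j = k then (v : ℝ) else 0 := by
  split_ifs with h
  · subst h
    simpa [sq] using integral_sq_of_hasLaw_gaussianReal (hZ j)
  · rw [(hind.indepFun h).integral_fun_mul_eq_mul_integral
      (hZ j).aemeasurable.aestronglyMeasurable (hZ k).aemeasurable.aestronglyMeasurable,
      integral_of_hasLaw_gaussianReal (hZ j), zero_mul]

end gaussian

/-! ### Second moments of the centred Gram matrix -/

section gram
variable {Ω : Type*} [MeasurableSpace Ω] {μ : Measure Ω} {v : ℝ≥0}
  {m n : Type*} [DecidableEq n] {X : Ω → Matrix m n ℝ}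

theorem indepFun_gram_centered (hX : ∀ i j, HasLaw (fun ω => X ω i j) (gaussianReal 0 v) μ)
    (hind : iIndepFun (fun (p : m × n) ω => X ω p.1 p.2) μ) {i i' : m} (hi : i ≠ i') (j k : n) :
    IndepFun (fun ω => X ω i j * X ω i k - if j = k then (v : ℝ) else 0)
      (fun ω => X ω i' j * X ω i' k - if j = k then (v : ℝ) else 0) μ := by
  have h := hind.indepFun_prodMk_prodMk₀ (fun p => (hX p.1 p.2).aemeasurable)
    (i, j) (i, k) (i', j) (i', k) (by simp [hi]) (by simp [hi]) (by simp [hi]) (by simp [hi])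
  exact h.comp (φ := fun x : ℝ × ℝ => x.1 * x.2 - if j = k then (v : ℝ) else 0)
    (ψ := fun x : ℝ × ℝ => x.1 * x.2 - if j = k then (v : ℝ) else 0) (by fun_prop) (by fun_prop)

variable [IsProbabilityMeasure μ]

theorem memLp_gram_centered (hX : ∀ i j, HasLaw (fun ω => X ω i j) (gaussianReal 0 v) μ)
    (i : m) (j k : n) :
    MemLp (fun ω => X ω i j * X ω i k - if j = k then (v : ℝ) else 0) 2 μ :=
  (memLp_two_mul_of_hasLaw_gaussianReal (hX i j) (hX i k)).sub (memLp_const _)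

theorem integral_gram_centered (hX : ∀ i j, HasLaw (fun ω => X ω i j) (gaussianReal 0 v) μ)
    (hind : iIndepFun (fun (p : m × n) ω => X ω p.1 p.2) μ) (i : m) (j k : n) :
    ∫ ω, (X ω i j * X ω i k - if j = k then (v : ℝ) else 0) ∂μ = 0 := by
  classical
  rw [integral_sub ((memLp_two_mul_of_hasLaw_gaussianReal (hX i j) (hX i k)).integrable
    one_le_two) (integrable_const _)]
  have := integral_mul_of_iIndepFun_gaussianReal (Z := fun (p : m × n) ω => X ω p.1 p.2)
    (fun p => hX p.1 p.2) hind (i, j) (i, k)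
  simp only [Prod.mk.injEq, true_and] at this
  rw [this]; simp

/-- The diagonal value is `3v² - v² = 2v²`. This excess `v²` on the diagonal is the source of `P +
1` rather than `P` in the final bound. -/
theorem integral_gram_centered_sq (hX : ∀ i j, HasLaw (fun ω => X ω i j) (gaussianReal 0 v) μ)
    (hind : iIndepFun (fun (p : m × n) ω => X ω p.1 p.2) μ) (i : m) (j k : n) :
    ∫ ω, (X ω i j * X ω i k - if j = k then (v : ℝ) else 0) ^ 2 ∂μ
      = (v : ℝ) ^ 2 + if j = k then (v : ℝ) ^ 2 else 0 := by
  split_ifs with h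
  · subst h
    have e : ∀ ω, (X ω i j * X ω i j - v) ^ 2
        = X ω i j ^ 4 - 2 * v * X ω i j ^ 2 + (v : ℝ) ^ 2 := fun ω => by ring
    have i2 : Integrable (fun ω => X ω i j ^ 2) μ := 
      (memLp_of_hasLaw_gaussianReal (hX i j) (p := 2) (by simp)).integrable_sq
    have i4 : Integrable (fun ω => X ω i j ^ 4) μ := by
      have := (memLp_two_mul_of_hasLaw_gaussianReal (hX i j) (hX i j)).integrable_sq
      refine this.congr (ae_of_all _ fun ω => ?_)
      simp only; ring
    have i3 : Integrable (fun ω => X ω i j ^ 4 - 2 * v * X ω i j ^ 2) μ := i4.sub (i2.const_mul _)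
    rw [integral_congr_ae (ae_of_all _ e), integral_add i3 (integrable_const _),
      integral_sub i4 (i2.const_mul _), integral_const_mul,
      integral_pow_four_of_hasLaw_gaussianReal (hX i j),
      integral_sq_of_hasLaw_gaussianReal (hX i j)]
    simp; ring
  · have hjk : ((i, j) : m × n) ≠ (i, k) := by simpa using h
    have hI := (hind.indepFun hjk).comp (φ := fun x : ℝ => x ^ 2) (ψ := fun x : ℝ => x ^ 2)
      (by fun_prop) (by fun_prop)
    have := hI.integral_mul_eq_mul_integral
      ((hX i j).aemeasurable.pow_const 2).aestronglyMeasurable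
      ((hX i k).aemeasurable.pow_const 2).aestronglyMeasurable
    simp only [Pi.mul_apply, Function.comp_apply,
      integral_sq_of_hasLaw_gaussianReal (hX _ _)] at this
    simp only [sub_zero, mul_pow, this]
    ring

variable [Fintype m]

/-- The summands come from distinct rows, hence are pairwise independent and centred, so variances
add. -/
theorem integral_sum_gram_centered_sq
    (hX : ∀ i j, HasLaw (fun ω => X ω i j) (gaussianReal 0 v) μ)
    (hind : iIndepFun (fun (p : m × n) ω => X ω p.1 p.2) μ) (j k : n) :
    ∫ ω, (∑ i, (X ω i j * X ω i k - if j = k then (v : ℝ) else 0)) ^ 2 ∂μ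
      = Fintype.card m * ((v : ℝ) ^ 2 + if j = k then (v : ℝ) ^ 2 else 0) := by
  have hM := fun i => memLp_gram_centered hX i j k
  have h := IndepFun.variance_sum (s := Finset.univ) (fun i _ => hM i)
    (fun i _ i' _ hi => indepFun_gram_centered hX hind hi j k)
  have hz : ∀ i, ∫ ω, (X ω i j * X ω i k - if j = k then (v : ℝ) else 0) ∂μ = 0 :=
    fun i => integral_gram_centered hX hind i j k
  have e : (∑ i, fun ω => X ω i j * X ω i k - if j = k then (v : ℝ) else 0)
      = fun ω => ∑ i, (X ω i j * X ω i k - if j = k then (v : ℝ) else 0) := by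
    funext ω; simp only [Finset.sum_apply]
  rw [e, variance_of_integral_eq_zero] at h
  · rw [h, Finset.sum_congr rfl fun i _ => (variance_of_integral_eq_zero
      (hM i).aestronglyMeasurable.aemeasurable (hz i)).trans
      (integral_gram_centered_sq hX hind i j k), Finset.sum_const, Finset.card_univ,
      nsmul_eq_mul]
  · exact (memLp_finsetSum _ fun i _ => hM i).aestronglyMeasurable.aemeasurable
  · rw [integral_finsetSum _ fun i _ => (hM i).integrable one_le_two]
    simp [hz]

theorem smul_gram_sub_apply {c a v : ℝ} (ha : a = c * (Fintype.card m * v)) (M : Matrix m n ℝ)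
    (j k : n) : (c • (Mᵀ * M) - a • (1 : Matrix n n ℝ)) j k
      = c * ∑ i, (M i j * M i k - if j = k then v else 0) := by
  rw [ha, Matrix.sub_apply, Matrix.smul_apply, Matrix.smul_apply, Matrix.mul_apply,
    Matrix.one_apply, Finset.sum_sub_distrib]
  split_ifs <;> simp [mul_sub]

variable [Fintype n]

theorem trace_gram_centered {c a v : ℝ} (ha : a = c * (Fintype.card m * v)) (M : Matrix m n ℝ) :
    (c • (Mᵀ * M) - a • (1 : Matrix n n ℝ)).trace
      = ∑ j, c * ∑ i, (M i j * M i j - if j = j then v else 0) :=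
  Finset.sum_congr rfl fun j _ => smul_gram_sub_apply ha M j j

theorem integrable_trace_gram_centered
    (hX : ∀ i j, HasLaw (fun ω => X ω i j) (gaussianReal 0 v) μ) {c a : ℝ}
    (ha : a = c * (Fintype.card m * v)) :
    Integrable (fun ω => (c • ((X ω)ᵀ * X ω) - a • (1 : Matrix n n ℝ)).trace) μ := by
  refine Integrable.congr ?_ (ae_of_all _ fun ω => (trace_gram_centered ha (X ω)).symm)
  exact integrable_finsetSum _ fun j _ => (integrable_finsetSum _ fun i _ =>
    (memLp_gram_centered hX i j j).integrable one_le_two).const_mul _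

theorem integral_trace_gram_centered
    (hX : ∀ i j, HasLaw (fun ω => X ω i j) (gaussianReal 0 v) μ)
    (hind : iIndepFun (fun (p : m × n) ω => X ω p.1 p.2) μ) {c a : ℝ}
    (ha : a = c * (Fintype.card m * v)) :
    ∫ ω, (c • ((X ω)ᵀ * X ω) - a • (1 : Matrix n n ℝ)).trace ∂μ = 0 := by
  have hi := fun i j => (memLp_gram_centered hX i j j).integrable one_le_two
  rw [integral_congr_ae (ae_of_all _ fun ω => trace_gram_centered ha (X ω))]
  rw [integral_finsetSum _ fun j _ => (integrable_finsetSum _ fun i _ => hi i j).const_mul _]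
  refine Finset.sum_eq_zero fun j _ => ?_
  rw [integral_const_mul, integral_finsetSum _ fun i _ => hi i j,
    Finset.sum_eq_zero fun i _ => integral_gram_centered hX hind i j j, mul_zero]

theorem trace_gram_centered_sq {c a v : ℝ} (ha : a = c * (Fintype.card m * v))
    (M : Matrix m n ℝ) :
    ((c • (Mᵀ * M) - a • (1 : Matrix n n ℝ)) * (c • (Mᵀ * M) - a • (1 : Matrix n n ℝ))).trace
      = ∑ j, ∑ k, c ^ 2 * (∑ i, (M i j * M i k - if j = k then v else 0)) ^ 2 := by
  rw [Matrix.trace]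
  refine Finset.sum_congr rfl fun j _ => ?_
  rw [Matrix.diag_apply, Matrix.mul_apply]
  refine Finset.sum_congr rfl fun k _ => ?_
  have e : ∀ i, (M i k * M i j - if k = j then v else 0) = M i j * M i k - if j = k then v else 0 :=
    fun i => by rw [mul_comm, if_congr eq_comm rfl rfl]
  rw [smul_gram_sub_apply ha, smul_gram_sub_apply ha, Finset.sum_congr rfl fun i _ => e i]
  ring

theorem integrable_trace_gram_centered_sq
    (hX : ∀ i j, HasLaw (fun ω => X ω i j) (gaussianReal 0 v) μ) {c a : ℝ}
    (ha : a = c * (Fintype.card m * v)) :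
    Integrable (fun ω => ((c • ((X ω)ᵀ * X ω) - a • (1 : Matrix n n ℝ)) *
      (c • ((X ω)ᵀ * X ω) - a • (1 : Matrix n n ℝ))).trace) μ := by
  simp only [trace_gram_centered_sq ha]
  exact integrable_finsetSum _ fun j _ => integrable_finsetSum _ fun k _ =>
    ((memLp_finsetSum _ fun i _ => memLp_gram_centered hX i j k).integrable_sq).const_mul _

theorem integral_trace_gram_centered_sq
    (hX : ∀ i j, HasLaw (fun ω => X ω i j) (gaussianReal 0 v) μ)
    (hind : iIndepFun (fun (p : m × n) ω => X ω p.1 p.2) μ) {c a : ℝ}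
    (ha : a = c * (Fintype.card m * v)) :
    ∫ ω, ((c • ((X ω)ᵀ * X ω) - a • (1 : Matrix n n ℝ)) *
      (c • ((X ω)ᵀ * X ω) - a • (1 : Matrix n n ℝ))).trace ∂μ
      = c ^ 2 * Fintype.card m * (v : ℝ) ^ 2 * (Fintype.card n * (Fintype.card n + 1)) := by
  have hi := fun j k => ((memLp_finsetSum Finset.univ
    fun i _ => memLp_gram_centered hX i j k).integrable_sq).const_mul (c ^ 2)
  simp only [trace_gram_centered_sq ha]
  rw [integral_finsetSum _ fun j _ => integrable_finsetSum _ fun k _ => hi j k]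
  have e : ∀ j, ∫ ω, ∑ k, c ^ 2 * (∑ i, (X ω i j * X ω i k - if j = k then (v : ℝ) else 0)) ^ 2 ∂μ
      = c ^ 2 * Fintype.card m * (v : ℝ) ^ 2 * (Fintype.card n + 1) := by
    intro j
    rw [integral_finsetSum _ fun k _ => hi j k]
    simp only [integral_const_mul, integral_sum_gram_centered_sq hX hind]
    rw [← Finset.mul_sum, ← Finset.mul_sum, Finset.sum_add_distrib]
    simp
    ring
  simp only [e, Finset.sum_const, Finset.card_univ, nsmul_eq_mul]
  ring

/-- The quadratic bound on the expected trace of the regularized inverse Gram matrix. -/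
theorem integral_trace_smul_gramInv_le
    (hX : ∀ i j, HasLaw (fun ω => X ω i j) (gaussianReal 0 v) μ)
    (hind : iIndepFun (fun (p : m × n) ω => X ω p.1 p.2) μ) {c a : ℝ} (hc : 0 < c)
    (ha : a = c * (Fintype.card m * v))
    (hint : Integrable (fun ω => ((1 / c) • gramInv c (X ω)).trace) μ) :
    ∫ ω, ((1 / c) • gramInv c (X ω)).trace ∂μ
      ≤ Fintype.card n / (1 + a)
        + c ^ 2 * Fintype.card m * (v : ℝ) ^ 2 * (Fintype.card n * (Fintype.card n + 1))
          / (1 + a) ^ 2 := by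
  classical
  have ha0 : 0 ≤ a := by rw [ha]; positivity
  have h1 := (integrable_trace_gram_centered hX ha).div_const ((1 + a) ^ 2)
  have h2 := (integrable_trace_gram_centered_sq hX ha).div_const ((1 + a) ^ 2)
  have h0 := integrable_const (μ := μ) ((Fintype.card n : ℝ) / (1 + a))
  refine (integral_mono hint ((h0.sub h1).add h2)
    fun ω => trace_smul_gramInv_le hc ha0 (X ω)).trans_eq ?_
  rw [integral_add' (h0.sub h1) h2, integral_sub' h0 h1, integral_div, integral_div,
    integral_trace_gram_centered hX hind ha]
  rw [integral_div, integral_trace_gram_centered_sq hX hind ha]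
  simp

end gram
-- Averaging over the independent noise
section noise
variable {Ω : Type*} [MeasurableSpace Ω] {μ : Measure Ω} {v : ℝ≥0}
  {n τ : Type*} [MeasurableSpace τ] {T : Ω → τ} {Z : Ω → n → ℝ}

theorem integral_mul_of_indepFun (hT : AEMeasurable T μ) (hTZ : IndepFun T Z μ)
    {φ : τ → ℝ} (hφ : Measurable φ)
    {ψ : (n → ℝ) → ℝ} (hψ : Measurable ψ) (hi : Integrable (fun ω => ψ (Z ω)) μ) :
    ∫ ω, φ (T ω) * ψ (Z ω) ∂μ = (∫ ω, φ (T ω) ∂μ) * ∫ ω, ψ (Z ω) ∂μ :=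
  (hTZ.comp hφ hψ).integral_fun_mul_eq_mul_integral
    (hφ.comp_aemeasurable hT).aestronglyMeasurable hi.aestronglyMeasurable

variable [IsProbabilityMeasure μ]

theorem integrable_comp_of_bounded (hT : AEMeasurable T μ) {φ : τ → ℝ} (hφ : Measurable φ)
    {C : ℝ} (hC : ∀ t, |φ t| ≤ C) : Integrable (fun ω => φ (T ω)) μ :=
  Integrable.of_bound (hφ.comp_aemeasurable hT).aestronglyMeasurable C (ae_of_all _ fun ω => hC (T ω))

theorem integrable_mul_of_indepFun (hT : AEMeasurable T μ) (hTZ : IndepFun T Z μ)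
    {φ : τ → ℝ} (hφ : Measurable φ) {C : ℝ} (hC : ∀ t, |φ t| ≤ C)
    {ψ : (n → ℝ) → ℝ} (hψ : Measurable ψ) (hi : Integrable (fun ω => ψ (Z ω)) μ) :
    Integrable (fun ω => φ (T ω) * ψ (Z ω)) μ :=
  (hTZ.comp hφ hψ).integrable_mul (integrable_comp_of_bounded hT hφ hC) hi

variable [Fintype n]

/-- Second moment of `α + ∑ j, η j * Z j` for Gaussian noise `Z` independent of the bounded
coefficients `α` and `η`. -/
theorem integrable_integral_add_noise_sq [DecidableEq n] (hT : AEMeasurable T μ)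
    (hTZ : IndepFun T Z μ)
    (hZ : ∀ j, HasLaw (fun ω => Z ω j) (gaussianReal 0 v) μ)
    (hind : iIndepFun (fun j ω => Z ω j) μ)
    {α : τ → ℝ} (hα : Measurable α) {A : ℝ} (hA : ∀ t, |α t| ≤ A)
    {η : n → τ → ℝ} (hη : ∀ j, Measurable (η j)) {B : ℝ} (hB : ∀ j t, |η j t| ≤ B) :
    Integrable (fun ω => (α (T ω) + ∑ j, η j (T ω) * Z ω j) ^ 2) μ ∧
    ∫ ω, (α (T ω) + ∑ j, η j (T ω) * Z ω j) ^ 2 ∂μ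
      = ∫ ω, α (T ω) ^ 2 ∂μ + v * ∑ j, ∫ ω, η j (T ω) ^ 2 ∂μ := by
  have hZ2 (j : n) : MemLp (fun ω => Z ω j) 2 μ := memLp_of_hasLaw_gaussianReal (hZ j) (by simp)
  have hZ1 (j : n) : Integrable (fun ω => Z ω j) μ := (hZ2 j).integrable one_le_two
  have hZZ (j k : n) : Integrable (fun ω => Z ω j * Z ω k) μ := (hZ2 j).integrable_mul (hZ2 k)
  -- In this expansion each term is a bounded function of `T` times a function of `Z`, so
  -- independence factors its integral. The linear terms vanish, and only `j = k` survives in the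
  -- double sum.
  have e : ∀ ω, (α (T ω) + ∑ j, η j (T ω) * Z ω j) ^ 2
      = α (T ω) ^ 2 + ∑ j, (2 * α (T ω) * η j (T ω)) * Z ω j
        + ∑ j, ∑ k, (η j (T ω) * η k (T ω)) * (Z ω j * Z ω k) := by
    intro ω
    rw [add_sq, sq (∑ j, η j (T ω) * Z ω j), Finset.sum_mul_sum, Finset.mul_sum]
    congr 1
    · congr 1
      exact Finset.sum_congr rfl fun j _ => by ring
    · exact Finset.sum_congr rfl fun j _ => Finset.sum_congr rfl fun k _ => by ring
  have bA : ∀ t, |α t ^ 2| ≤ A ^ 2 := fun t => by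
    rw [abs_pow]; exact pow_le_pow_left₀ (abs_nonneg _) (hA t) 2
  have bAB : ∀ j t, |2 * α t * η j t| ≤ 2 * A * B := fun j t => by
    rw [abs_mul, abs_mul, abs_two]
    have := (abs_nonneg _).trans (hA t)
    gcongr
    exacts [hA t, hB j t]
  have bB : ∀ j k t, |η j t * η k t| ≤ B * B := fun j k t => by
    rw [abs_mul]
    have := (abs_nonneg _).trans (hB j t)
    gcongr
    exacts [hB j t, hB k t]
  have m1 (j : n) : Measurable fun t => 2 * α t * η j t := (hα.const_mul 2).mul (hη j)
  have m2 (j k : n) : Measurable fun t => η j t * η k t := (hη j).mul (hη k)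
  have i0 : Integrable (fun ω => α (T ω) ^ 2) μ :=
    integrable_comp_of_bounded hT (hα.pow_const 2) bA
  have i1 (j : n) : Integrable (fun ω => (2 * α (T ω) * η j (T ω)) * Z ω j) μ :=
    integrable_mul_of_indepFun hT hTZ (m1 j) (bAB j) (measurable_pi_apply j) (hZ1 j)
  have i2 (j k : n) : Integrable (fun ω => (η j (T ω) * η k (T ω)) * (Z ω j * Z ω k)) μ :=
    integrable_mul_of_indepFun hT hTZ (m2 j k) (bB j k)
      (ψ := fun z => z j * z k) (by fun_prop) (hZZ j k)
  have s1 : Integrable (fun ω => ∑ j, (2 * α (T ω) * η j (T ω)) * Z ω j) μ :=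
    integrable_finsetSum _ fun j _ => i1 j
  have s2 : Integrable (fun ω => ∑ j, ∑ k, (η j (T ω) * η k (T ω)) * (Z ω j * Z ω k)) μ :=
    integrable_finsetSum _ fun j _ => integrable_finsetSum _ fun k _ => i2 j k
  have s01 : Integrable (fun ω => α (T ω) ^ 2 + ∑ j, (2 * α (T ω) * η j (T ω)) * Z ω j) μ :=
    i0.add s1
  have z1 (j : n) : ∫ ω, (2 * α (T ω) * η j (T ω)) * Z ω j ∂μ = 0 := by
    rw [integral_mul_of_indepFun hT hTZ (m1 j) (measurable_pi_apply j) (hZ1 j),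
      integral_of_hasLaw_gaussianReal (hZ j), mul_zero]
  have z2 (j k : n) : ∫ ω, (η j (T ω) * η k (T ω)) * (Z ω j * Z ω k) ∂μ
      = if j = k then v * ∫ ω, η j (T ω) ^ 2 ∂μ else 0 := by
    rw [integral_mul_of_indepFun hT hTZ (m2 j k) (ψ := fun z => z j * z k) (by fun_prop) (hZZ j k),
      integral_mul_of_iIndepFun_gaussianReal hZ hind]
    split_ifs with h
    · subst h
      simp only [sq, mul_comm]
    · rw [mul_zero]
  simp_rw [e]
  refine ⟨s01.add s2, ?_⟩
  rw [integral_add s01 s2, integral_add i0 s1, integral_finsetSum _ fun j _ => i1 j,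
    integral_finsetSum _ fun j _ => integrable_finsetSum _ fun k _ => i2 j k,
    Finset.sum_congr rfl fun j _ => z1 j,
    Finset.sum_congr rfl fun j _ => (integral_finsetSum _ fun k _ => i2 j k)]
  simp only [z2]
  simp [Finset.mul_sum]

end noise

/-! ### Signed-permutation invariance and isotropy -/

section symmetry
variable {Ω : Type*} [MeasurableSpace Ω] {μ : Measure Ω} {v : ℝ≥0}
  {m n : Type*} [Fintype m] [Fintype n] {X X' : Ω → Matrix m n ℝ}

theorem measurable_comp_of_uncurry {F : Matrix m n ℝ → ℝ} (hF : Continuous F) :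
    Measurable fun x : m × n → ℝ => F (Matrix.of fun i j => x (i, j)) := by
  have : Continuous fun x : m × n → ℝ => (Matrix.of fun i j => x (i, j) : Matrix m n ℝ) :=
    continuous_matrix fun i j => continuous_apply (i, j)
  exact (hF.comp this).measurable

/-- Both joint entry laws are the same product measure, so an invariance of the design need only be
checked on entry laws and independence. -/
theorem integral_comp_eq_of_iIndepFun_gaussianReal
    (hX : ∀ i j, HasLaw (fun ω => X ω i j) (gaussianReal 0 v) μ)
    (hind : iIndepFun (fun (p : m × n) ω => X ω p.1 p.2) μ)
    (hX' : ∀ i j, HasLaw (fun ω => X' ω i j) (gaussianReal 0 v) μ)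
    (hind' : iIndepFun (fun (p : m × n) ω => X' ω p.1 p.2) μ)
    {F : Matrix m n ℝ → ℝ} (hF : Continuous F) :
    ∫ ω, F (X ω) ∂μ = ∫ ω, F (X' ω) ∂μ := by
  have h := hind.hasLaw_pi (fun p : m × n => hX p.1 p.2)
  have h' := hind'.hasLaw_pi (fun p : m × n => hX' p.1 p.2)
  have hm := (measurable_comp_of_uncurry hF).aestronglyMeasurable
    (μ := Measure.pi fun _ : m × n => gaussianReal 0 v)
  exact (h.integral_comp hm).trans (h'.integral_comp hm).symm

theorem aemeasurable_uncurry (hX : ∀ i j, HasLaw (fun ω => X ω i j) (gaussianReal 0 v) μ) :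
    AEMeasurable (fun ω (p : m × n) => X ω p.1 p.2) μ :=
  aemeasurable_pi_iff.2 fun p => (hX p.1 p.2).aemeasurable

theorem integrable_comp_of_continuous_bounded [IsProbabilityMeasure μ]
    (hX : ∀ i j, HasLaw (fun ω => X ω i j) (gaussianReal 0 v) μ)
    {F : Matrix m n ℝ → ℝ} (hF : Continuous F) {C : ℝ} (hC : ∀ M, |F M| ≤ C) :
    Integrable (fun ω => F (X ω)) μ :=
  integrable_comp_of_bounded (aemeasurable_uncurry hX) (measurable_comp_of_uncurry hF)
    fun _ => hC _

variable [DecidableEq m]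

theorem integral_comp_signFlip
    (hX : ∀ i j, HasLaw (fun ω => X ω i j) (gaussianReal 0 v) μ)
    (hind : iIndepFun (fun (p : m × n) ω => X ω p.1 p.2) μ)
    {s : m → ℝ} (hs : ∀ i, s i = 1 ∨ s i = -1) {F : Matrix m n ℝ → ℝ} (hF : Continuous F) :
    ∫ ω, F (X ω) ∂μ = ∫ ω, F (Matrix.diagonal s * X ω) ∂μ := by
  refine integral_comp_eq_of_iIndepFun_gaussianReal hX hind (fun i j => ?_) ?_ hF
  · simp only [Matrix.diagonal_mul]
    rcases hs i with h | h
    · simpa [h] using hX i j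
    · simpa [h, Pi.neg_def] using gaussianReal_neg (hX i j)
  · simp only [Matrix.diagonal_mul]
    exact hind.comp (fun p x => s p.1 * x) fun p => by fun_prop

theorem integral_comp_permMatrix
    (hX : ∀ i j, HasLaw (fun ω => X ω i j) (gaussianReal 0 v) μ)
    (hind : iIndepFun (fun (p : m × n) ω => X ω p.1 p.2) μ)
    (σ : Equiv.Perm m) {F : Matrix m n ℝ → ℝ} (hF : Continuous F) :
    ∫ ω, F (X ω) ∂μ = ∫ ω, F (σ.permMatrix ℝ * X ω) ∂μ := by
  refine integral_comp_eq_of_iIndepFun_gaussianReal hX hind (fun i j => ?_) ?_ hF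
  · simpa [Equiv.Perm.permMatrix, PEquiv.toMatrix_toPEquiv_mul] using hX (σ i) j
  · simp only [Equiv.Perm.permMatrix, PEquiv.toMatrix_toPEquiv_mul, Matrix.submatrix_apply]
    exact hind.precomp (g := fun p : m × n => (σ p.1, p.2))
      fun p q h => by simpa [Prod.ext_iff] using h

variable [DecidableEq n]

theorem continuous_residual_sq_apply {c : ℝ} (hc : 0 < c) (i j : m) :
    Continuous fun M : Matrix m n ℝ => (residual c M * residual c M) i j :=
  ((continuous_residual hc).matrix_mul (continuous_residual hc)).matrix_elem i j

/-- Flipping the sign of row `i` preserves the law of the design but negates this entry of `K²`. -/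
theorem integral_residual_sq_offDiag
    (hX : ∀ i j, HasLaw (fun ω => X ω i j) (gaussianReal 0 v) μ)
    (hind : iIndepFun (fun (p : m × n) ω => X ω p.1 p.2) μ) {c : ℝ} (hc : 0 < c)
    {i j : m} (hij : i ≠ j) :
    ∫ ω, (residual c (X ω) * residual c (X ω)) i j ∂μ = 0 := by
  set s : m → ℝ := fun k => if k = i then -1 else 1 with hs
  have hs2 : ∀ k, s k = 1 ∨ s k = -1 := fun k => by
    by_cases h : k = i <;> simp [hs, h]
  have hU : (Matrix.diagonal s)ᵀ * Matrix.diagonal s = 1 := by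
    rw [Matrix.diagonal_transpose, Matrix.diagonal_mul_diagonal, ← Matrix.diagonal_one]
    congr 1
    funext k
    rcases hs2 k with h | h <;> simp [h]
  have h := integral_comp_signFlip hX hind hs2 (continuous_residual_sq_apply (n := n) hc i j)
  simp only [residual_sq_orthogonal_mul c hU, Matrix.diagonal_transpose, Matrix.mul_diagonal,
    Matrix.diagonal_mul] at h
  have h1 : s i = -1 := by simp [hs]
  have h2 : s j = 1 := by simp [hs, hij.symm]
  simp only [h1, h2, neg_one_mul, mul_one, integral_neg] at h
  linarith

/-- Swapping rows `i` and `j` preserves the law of the design and exchanges the two diagonal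
entries. -/
theorem integral_residual_sq_diag_eq
    (hX : ∀ i j, HasLaw (fun ω => X ω i j) (gaussianReal 0 v) μ)
    (hind : iIndepFun (fun (p : m × n) ω => X ω p.1 p.2) μ) {c : ℝ} (hc : 0 < c) (i j : m) :
    ∫ ω, (residual c (X ω) * residual c (X ω)) i i ∂μ
      = ∫ ω, (residual c (X ω) * residual c (X ω)) j j ∂μ := by
  have hU : ((Equiv.swap i j).permMatrix ℝ)ᵀ * (Equiv.swap i j).permMatrix ℝ = 1 := by
    rw [Matrix.transpose_permMatrix, ← Matrix.permMatrix_mul]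
    simp
  have h := integral_comp_permMatrix hX hind (Equiv.swap i j)
    (continuous_residual_sq_apply (n := n) hc i i)
  rw [h]
  refine integral_congr_ae (ae_of_all _ fun ω => ?_)
  simp only [residual_sq_orthogonal_mul c hU, Matrix.transpose_permMatrix]
  simp [Equiv.Perm.permMatrix, PEquiv.toMatrix_toPEquiv_mul, PEquiv.mul_toMatrix_toPEquiv]

theorem abs_residual_sq_le {c : ℝ} (hc : 0 < c) (M : Matrix m n ℝ) (i j : m) :
    |(residual c M * residual c M) i j| ≤ Fintype.card m := by
  rw [Matrix.mul_apply]
  refine (Finset.abs_sum_le_sum_abs _ _).trans ?_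
  calc ∑ k, |residual c M i k * residual c M k j| ≤ ∑ _k : m, (1 : ℝ) := by
        refine Finset.sum_le_sum fun k _ => ?_
        rw [abs_mul]
        exact mul_le_one₀ (abs_residual_le_one hc M i k) (abs_nonneg _)
          (abs_residual_le_one hc M k j)
    _ = _ := by simp

theorem sum_residual_mulVec_sq (c : ℝ) (M : Matrix m n ℝ) (d : m → ℝ) :
    ∑ i, (residual c M *ᵥ d) i ^ 2
      = ∑ i, ∑ j, d i * d j * (residual c M * residual c M) i j := by
  have h : (residual c M *ᵥ d) ⬝ᵥ (residual c M *ᵥ d)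
      = d ⬝ᵥ ((residual c M * residual c M) *ᵥ d) := by
    rw [← Matrix.mulVec_mulVec, Matrix.dotProduct_mulVec d, ← Matrix.mulVec_transpose,
      residual_transpose]
  calc ∑ i, (residual c M *ᵥ d) i ^ 2 = (residual c M *ᵥ d) ⬝ᵥ (residual c M *ᵥ d) := by
        simp only [dotProduct, sq]
    _ = _ := by
        rw [h]
        simp only [dotProduct, Matrix.mulVec, Finset.mul_sum]
        exact Finset.sum_congr rfl fun i _ => Finset.sum_congr rfl fun j _ => by ring

/-- Averaging over the Gaussian design makes the squared residual isotropic. -/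
theorem integral_sum_residual_mulVec_sq [IsProbabilityMeasure μ]
    (hX : ∀ i j, HasLaw (fun ω => X ω i j) (gaussianReal 0 v) μ)
    (hind : iIndepFun (fun (p : m × n) ω => X ω p.1 p.2) μ) {c : ℝ} (hc : 0 < c) (d : m → ℝ) :
    Fintype.card m * ∫ ω, ∑ i, (residual c (X ω) *ᵥ d) i ^ 2 ∂μ
      = (∑ i, d i ^ 2) * ∫ ω, (residual c (X ω) * residual c (X ω)).trace ∂μ := by
  have hint (i j : m) : Integrable (fun ω => (residual c (X ω) * residual c (X ω)) i j) μ :=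
    integrable_comp_of_continuous_bounded hX (continuous_residual_sq_apply hc i j)
      fun M => abs_residual_sq_le hc M i j
  have htr : ∀ i, ∫ ω, (residual c (X ω) * residual c (X ω)).trace ∂μ
      = Fintype.card m * ∫ ω, (residual c (X ω) * residual c (X ω)) i i ∂μ := by
    intro i
    simp only [Matrix.trace, Matrix.diag_apply]
    rw [integral_finsetSum _ fun j _ => hint j j,
      Finset.sum_congr rfl fun j _ => integral_residual_sq_diag_eq hX hind hc j i]
    simp
  simp only [sum_residual_mulVec_sq]
  rw [integral_finsetSum _ fun i _ => integrable_finsetSum _ fun j _ => (hint i j).const_mul _,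
    Finset.mul_sum, Finset.sum_mul]
  refine Finset.sum_congr rfl fun i _ => ?_
  rw [integral_finsetSum _ fun j _ => (hint i j).const_mul _, htr i,
    Finset.sum_eq_single i]
  · rw [integral_const_mul]; ring
  · intro j _ hj
    rw [integral_const_mul, integral_residual_sq_offDiag hX hind hc hj.symm, mul_zero]
  · simp

end symmetry
-- Expected squared error of one update
section risk
variable {Ω : Type*} [MeasurableSpace Ω] {μ : Measure Ω} [IsProbabilityMeasure μ] {v s : ℝ≥0}
  {m n : Type*} [Fintype m] [Fintype n] [DecidableEq m] [DecidableEq n]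
  {X : Ω → Matrix m n ℝ} {Z : Ω → n → ℝ}

/-- Expected squared error after one update, before averaging over the design. -/
theorem integrable_integral_sum_update_sq
    (hX : ∀ i j, HasLaw (fun ω => X ω i j) (gaussianReal 0 v) μ)
    (hZ : ∀ j, HasLaw (fun ω => Z ω j) (gaussianReal 0 s) μ)
    (hZind : iIndepFun (fun j ω => Z ω j) μ)
    (hXZ : IndepFun (fun ω (p : m × n) => X ω p.1 p.2) Z μ) {c : ℝ} (hc : 0 < c) (d : m → ℝ) :
    Integrable (fun ω => ∑ i, ((residual c (X ω) *ᵥ d) i + (gain c (X ω) *ᵥ Z ω) i) ^ 2) μ ∧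
    ∫ ω, ∑ i, ((residual c (X ω) *ᵥ d) i + (gain c (X ω) *ᵥ Z ω) i) ^ 2 ∂μ
      = ∫ ω, ∑ i, (residual c (X ω) *ᵥ d) i ^ 2 ∂μ
        + s * ∫ ω, (gain c (X ω) * (gain c (X ω))ᵀ).trace ∂μ := by
  have cα (i : m) : Continuous fun M : Matrix m n ℝ => (residual c M *ᵥ d) i :=
    (continuous_apply i).comp ((continuous_residual hc).matrix_mulVec continuous_const)
  have cη (i : m) (j : n) : Continuous fun M : Matrix m n ℝ => gain c M i j :=
    (continuous_gain hc).matrix_elem i j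
  have bα (i : m) (M : Matrix m n ℝ) : |(residual c M *ᵥ d) i| ≤ ∑ k, |d k| := by
    refine (Finset.abs_sum_le_sum_abs _ _).trans (Finset.sum_le_sum fun k _ => ?_)
    rw [abs_mul]
    exact mul_le_of_le_one_left (abs_nonneg _) (abs_residual_le_one hc M i k)
  have h (i : m) := integrable_integral_add_noise_sq (aemeasurable_uncurry hX) hXZ hZ hZind
    (measurable_comp_of_uncurry (cα i)) (fun x => bα i _)
    (η := fun j x => gain c (Matrix.of fun i j => x (i, j)) i j)
    (fun j => measurable_comp_of_uncurry (cη i j)) (fun j x => abs_gain_le hc _ i j)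
  have iα (i : m) : Integrable (fun ω => (residual c (X ω) *ᵥ d) i ^ 2) μ :=
    integrable_comp_of_continuous_bounded hX ((cα i).pow 2) (C := (∑ k, |d k|) ^ 2) fun M => by
      rw [Pi.pow_apply, abs_pow]; exact pow_le_pow_left₀ (abs_nonneg _) (bα i M) 2
  have iη (i : m) (j : n) : Integrable (fun ω => gain c (X ω) i j ^ 2) μ :=
    integrable_comp_of_continuous_bounded hX ((cη i j).pow 2) (C := (√c) ^ 2) fun M => by
      rw [Pi.pow_apply, abs_pow]; exact pow_le_pow_left₀ (abs_nonneg _) (abs_gain_le hc M i j) 2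
  have h1 (i : m) : Integrable
      (fun ω => ((residual c (X ω) *ᵥ d) i + (gain c (X ω) *ᵥ Z ω) i) ^ 2) μ := (h i).1
  have h2 (i : m) : ∫ ω, ((residual c (X ω) *ᵥ d) i + (gain c (X ω) *ᵥ Z ω) i) ^ 2 ∂μ
      = ∫ ω, (residual c (X ω) *ᵥ d) i ^ 2 ∂μ + s * ∑ j, ∫ ω, gain c (X ω) i j ^ 2 ∂μ := (h i).2
  have ht : ∀ ω, (gain c (X ω) * (gain c (X ω))ᵀ).trace = ∑ i, ∑ j, gain c (X ω) i j ^ 2 := by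
    intro ω
    simp only [Matrix.trace, Matrix.diag_apply, Matrix.mul_apply, Matrix.transpose_apply, sq]
  refine ⟨integrable_finsetSum _ fun i _ => h1 i, ?_⟩
  rw [integral_finsetSum _ fun i _ => h1 i, integral_finsetSum _ fun i _ => iα i,
    integral_congr_ae (ae_of_all _ ht),
    integral_finsetSum _ fun i _ => integrable_finsetSum _ fun j _ => iη i j,
    Finset.sum_congr rfl fun i _ => h2 i, Finset.sum_add_distrib, Finset.mul_sum]
  congr 1
  exact Finset.sum_congr rfl fun i _ => by rw [integral_finsetSum _ fun j _ => iη i j]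

/-- With the confidence parameter matched to the noise level, the expected squared error is the
normalized expected trace of the residual matrix. -/
theorem card_mul_integral_sum_update_sq
    (hX : ∀ i j, HasLaw (fun ω => X ω i j) (gaussianReal 0 v) μ)
    (hXind : iIndepFun (fun (p : m × n) ω => X ω p.1 p.2) μ)
    (hZ : ∀ j, HasLaw (fun ω => Z ω j) (gaussianReal 0 s) μ)
    (hZind : iIndepFun (fun j ω => Z ω j) μ)
    (hXZ : IndepFun (fun ω (p : m × n) => X ω p.1 p.2) Z μ) {c : ℝ} (hc : 0 < c) {d : m → ℝ}
    (hd : ∑ i, d i ^ 2 = c * (s * Fintype.card m)) :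
    Fintype.card m * ∫ ω, ∑ i, ((residual c (X ω) *ᵥ d) i + (gain c (X ω) *ᵥ Z ω) i) ^ 2 ∂μ
      = (∑ i, d i ^ 2) * ∫ ω, (residual c (X ω)).trace ∂μ := by
  have iQ : Integrable (fun ω => (residual c (X ω) * residual c (X ω)).trace) μ :=
    integrable_finsetSum _ fun i _ => integrable_comp_of_continuous_bounded hX
      (continuous_residual_sq_apply hc i i) fun M => abs_residual_sq_le hc M i i
  have iK : Integrable (fun ω => (residual c (X ω)).trace) μ :=
    integrable_finsetSum _ fun i _ => integrable_comp_of_continuous_bounded hX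
      ((continuous_residual hc).matrix_elem i i) fun M => abs_residual_le_one hc M i i
  -- Under `hd` the factor `c` combines with `s` and the dimension into `∑ d i ^ 2`, so the `tr K²`
  -- terms cancel.
  have hg : ∀ ω, (gain c (X ω) * (gain c (X ω))ᵀ).trace
      = c * ((residual c (X ω)).trace - (residual c (X ω) * residual c (X ω)).trace) := by
    intro ω
    have h := congrArg Matrix.trace (residual_mul_self_add hc (X ω))
    rw [Matrix.trace_add, Matrix.trace_smul, smul_eq_mul] at h
    rw [← h]
    field_simp
    ring
  rw [(integrable_integral_sum_update_sq hX hZ hZind hXZ hc d).2, mul_add,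
    integral_sum_residual_mulVec_sq hX hXind hc, integral_congr_ae (ae_of_all _ hg),
    integral_const_mul, integral_sub iK iQ, hd]
  ring

theorem integral_trace_residual_le
    (hX : ∀ i j, HasLaw (fun ω => X ω i j) (gaussianReal 0 v) μ)
    (hXind : iIndepFun (fun (p : m × n) ω => X ω p.1 p.2) μ) {c a : ℝ} (hc : 0 < c)
    (ha : a = c * (Fintype.card m * v)) :
    ∫ ω, (residual c (X ω)).trace ∂μ
      ≤ Fintype.card m - Fintype.card n + (Fintype.card n / (1 + a)
        + c ^ 2 * Fintype.card m * (v : ℝ) ^ 2 * (Fintype.card n * (Fintype.card n + 1))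
          / (1 + a) ^ 2) := by
  have iK : Integrable (fun ω => (residual c (X ω)).trace) μ :=
    integrable_finsetSum _ fun i _ => integrable_comp_of_continuous_bounded hX
      ((continuous_residual hc).matrix_elem i i) fun M => abs_residual_le_one hc M i i
  have iG : Integrable (fun ω => ((1 / c) • gramInv c (X ω)).trace) μ := by
    refine (iK.sub (integrable_const ((Fintype.card m : ℝ) - Fintype.card n))).congr
      (ae_of_all _ fun ω => ?_)
    simp only [Pi.sub_apply, trace_residual hc]
    ring
  rw [integral_congr_ae (ae_of_all _ fun ω => trace_residual hc (X ω)),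
    integral_add (integrable_const _) iG]
  simpa using integral_trace_smul_gramInv_le hX hXind hc ha iG

end risk
end RidgeUpdate

open RidgeUpdate

/-! ### Assembly of the bound -/

theorem theorem1 :
    (∀ P : ℕ, (fun L : ℕ => gammaConst P L) =O[atTop] fun L : ℕ => √(Real.log L / L)) ∧
    ∀ {Ω : Type*} [MeasurableSpace Ω] (μ : Measure Ω) [IsProbabilityMeasure μ]
      (L P : ℕ) (_hLP : √(L : ℝ) - √(Real.log L) > √(P : ℝ))
      (σx σz : ℝ≥0) (_hσz : 0 < σz)
      (wstar w : EuclideanSpace ℝ (Fin L)) (_hw : w ≠ wstar)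
      (X : Ω → Matrix (Fin L) (Fin P) ℝ) (Z y : Ω → Fin P → ℝ)
      (_hX_law : ∀ i j, HasLaw (fun ω => X ω i j) (gaussianReal 0 (σx ^ 2)) μ)
      (_hX_indep : iIndepFun (fun (p : Fin L × Fin P) ω => X ω p.1 p.2) μ)
      (_hZ_law : ∀ j, HasLaw (fun ω => Z ω j) (gaussianReal 0 (σz ^ 2)) μ)
      (_hZ_indep : iIndepFun (fun (j : Fin P) ω => Z ω j) μ)
      (_hXZ : IndepFun (fun ω (p : Fin L × Fin P) => X ω p.1 p.2) Z μ)
      (_hy : ∀ ω, y ω = (X ω)ᵀ *ᵥ wstar.ofLp + Z ω),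
      Integrable (fun ω => ‖gaOBMLUpdate σz wstar w (X ω) (y ω) - wstar‖ ^ 2) μ ∧
      ∫ ω, ‖gaOBMLUpdate σz wstar w (X ω) (y ω) - wstar‖ ^ 2 ∂μ ≤
        (1 - (1 - gammaConst P L) * ((P : ℝ) / L) *
          (((σx : ℝ) ^ 2 * ‖w - wstar‖ ^ 2) /
            ((σz : ℝ) ^ 2 + (σx : ℝ) ^ 2 * ‖w - wstar‖ ^ 2))) * ‖w - wstar‖ ^ 2 := by
  refine ⟨gammaConst_isBigO, ?_⟩
  intro Ω _ μ _ L P hLP σx σz hσz wstar w hw X Z y hX hXind hZ hZind hXZ hy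
  have hL0 : (0 : ℝ) < L := by
    rcases Nat.eq_zero_or_pos L with rfl | h
    · simp at hLP
      exact absurd hLP (not_lt.2 (Real.sqrt_nonneg _))
    · exact_mod_cast h
  have hz0 : (0 : ℝ) < σz := hσz
  have hr0 : 0 < ‖w - wstar‖ ^ 2 := by
    have := norm_pos_iff.2 (sub_ne_zero.2 hw)
    positivity
  have hc : 0 < confidence σz wstar w := by
    rw [confidence]; positivity
  have hcdef : confidence σz wstar w = ‖w - wstar‖ ^ 2 / ((σz : ℝ) ^ 2 * L) := rfl
  have hnorm : ∑ i, (w - wstar).ofLp i ^ 2 = ‖w - wstar‖ ^ 2 :=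
    (EuclideanSpace.real_norm_sq_eq _).symm
  have hd : ∑ i, (w - wstar).ofLp i ^ 2
      = confidence σz wstar w * (((σz ^ 2 : ℝ≥0) : ℝ) * Fintype.card (Fin L)) := by
    rw [hnorm, hcdef, NNReal.coe_pow, Fintype.card_fin]
    field_simp
  have e : ∀ ω, ‖gaOBMLUpdate σz wstar w (X ω) (y ω) - wstar‖ ^ 2 = _ := fun ω =>
    (congrArg (fun u => ‖gaOBMLUpdate σz wstar w (X ω) u - wstar‖ ^ 2) (hy ω)).trans
      (norm_update_sub_sq (σz : ℝ) wstar w (X ω) (Z ω))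
  simp only [e]
  refine ⟨(integrable_integral_sum_update_sq hX hZ hZind hXZ hc _).1, ?_⟩
  have h1 := card_mul_integral_sum_update_sq hX hXind hZ hZind hXZ hc hd
  have h2 := integral_trace_residual_le hX hXind hc rfl
  rw [hnorm, Fintype.card_fin] at h1
  simp only [Fintype.card_fin, NNReal.coe_pow] at h2
  set E := ∫ ω, ∑ i, ((residual (confidence σz wstar w) (X ω) *ᵥ (w - wstar).ofLp) i
    + (gain (confidence σz wstar w) (X ω) *ᵥ Z ω) i) ^ 2 ∂μ
  have hE := h1.trans_le (mul_le_mul_of_nonneg_left h2 hr0.le)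
  rw [hcdef] at hE
  generalize ‖w - wstar‖ ^ 2 = r at *
  set ρ := (σx : ℝ) ^ 2 * r / ((σz : ℝ) ^ 2 + (σx : ℝ) ^ 2 * r) with hρ
  have hden : 0 < (σz : ℝ) ^ 2 + (σx : ℝ) ^ 2 * r := by positivity
  have hρ0 : 0 ≤ ρ := by positivity
  have hρ1 : ρ ≤ 1 := by
    rw [hρ, div_le_one hden]
    have : 0 < (σz : ℝ) ^ 2 := by positivity
    linarith
  have ha : 1 + r / ((σz : ℝ) ^ 2 * L) * (L * (σx : ℝ) ^ 2)
      = ((σz : ℝ) ^ 2 + (σx : ℝ) ^ 2 * r) / (σz : ℝ) ^ 2 := by field_simp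
  -- Here `a = σx² r / σz²`, so `1/(1+a) = 1 - ρ` and `c² L σx⁴ / (1+a)² = ρ² / L`; the trace bound
  -- becomes `L - Pρ + P(P+1)ρ²/L`.
  have hbound : L * E ≤ r * (L - P * ρ * (1 - ρ * ((P + 1) / L))) := by
    refine hE.trans_eq ?_
    rw [ha, hρ]
    field_simp
    ring
  -- Keeping the factor `P` makes `P = 0` trivial; the comparison of constants needs `P ≥ 1`.
  -- Otherwise `ρ ≤ 1` suffices.
  have hγ : (P : ℝ) * (1 - gammaConst P L) ≤ P * (1 - ρ * ((P + 1) / L)) := by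
    rcases Nat.eq_zero_or_pos P with rfl | hP
    · simp
    · have h := one_sub_gammaConst_le hP hLP
      have : ρ * (((P : ℝ) + 1) / L) ≤ (P + 1) / L :=
        mul_le_of_le_one_left (by positivity) hρ1
      exact mul_le_mul_of_nonneg_left (by linarith) (Nat.cast_nonneg P)
  have hfin : L * E ≤ r * (L - P * (1 - gammaConst P L) * ρ) := by
    refine hbound.trans (mul_le_mul_of_nonneg_left ?_ hr0.le)
    have := mul_le_mul_of_nonneg_right hγ hρ0
    linarith
  refine (le_div_iff₀' hL0).2 hfin |>.trans_eq ?_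
  field_simp
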